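/- Let $t \ge 3$, $q = 2^t$, $n = q+1$, and let $\alpha \in \mathbb{F}_q^*$ be an element of order $r$, where $q-1 = rk$. Then for every integer $i$ with $2 \le i \le \frac{n-1}{2} - 2$: (a) there exists an MDS convolutional code over $\mathbb{F}_q$ with parameters $(n, n-2i, 2; 1, 2i+3)_q$; (b) there exists an MDS convolutional code over $\mathbb{F}_q$ with parameters $(n, n-2i+1, 2; 1, 2i+2)_q$. Here a convolutional code with parameters $(n, \kappa, \gamma; m, d_f)_q$ is a submodule $C = \{\mathbf{u}(D)G(D) : \mathbf{u}(D) \in \mathbb{F}_q[D]^{\kappa}\}$ of $\mathbb{F}_q[D]^n$, where $G(D) = (g_{ij}) \in \mathbb{F}_q[D]^{\kappa\times n}$ is basic (it has a polynomial right inverse) and reduced (its overall constraint length $\sum_i \gamma_i$, with $\gamma_i = \max_j \deg g_{ij}$, is smallest among all basic generator matrices of $C$); $\gamma = \sum_i \gamma_i$ is the degree, $m = \max_i \gamma_i$ is the memory, and the free distance $d_f$ is the minimum weight of a nonzero codeword, the weight of $\mathbf{v}(D) = \sum_l \mathbf{v}_l D^l$ being the sum of the Hamming weights of the $\mathbf{v}_l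 \in \mathbb{F}_q^n$. The code is MDS if it attains the generalized Singleton bound with equality, that is, $d_f = (n-\kappa)\left(\lfloor \gamma/\kappa\rfloor + 1\right) + \gamma + 1$. -/

import Mathlib

open Polynomial

namespace ConvCode

variable {F : Type*} [Field F] {k n : ℕ}

/-- A polynomial `k × n` matrix is basic if it has a polynomial right inverse. -/
def IsBasic (G : Matrix (Fin k) (Fin n) F[X]) : Prop :=
  ∃ R : Matrix (Fin n) (Fin k) F[X], G * R = 1

/-- The submodule `{u(D) G(D) | u(D) ∈ F[D]^k}` of `F[D]^n`. -/
noncomputable def generatedBy (G : Matrix (Fin k) (Fin n) F[X]) : Submodule F[X] (Fin n → F[X]) :=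
  LinearMap.range G.vecMulLinear

/-- The `i`-th constraint length: the largest degree of an entry in row `i`. -/
noncomputable def rowDegree (G : Matrix (Fin k) (Fin n) F[X]) (i : Fin k) : ℕ :=
  Finset.univ.sup fun j => (G i j).natDegree

/-- The overall constraint length: the sum of the row degrees. -/
noncomputable def overallConstraintLength (G : Matrix (Fin k) (Fin n) F[X]) : ℕ :=
  ∑ i, rowDegree G i

/-- The memory: the largest row degree. -/
noncomputable def memory (G : Matrix (Fin k) (Fin n) F[X]) : ℕ :=
  Finset.univ.sup fun i => rowDegree G i

/-- A basic matrix is reduced if its overall constraint length is smallest among all basic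
generator matrices of the same code. -/
def IsReducedBasic (G : Matrix (Fin k) (Fin n) F[X]) : Prop :=
  IsBasic G ∧ ∀ G' : Matrix (Fin k) (Fin n) F[X], IsBasic G' →
    generatedBy G' = generatedBy G → overallConstraintLength G ≤ overallConstraintLength G'

/-- The Hamming weight of `v(D) = ∑ v_l D^l`: the total number of nonzero coordinates of the
vectors `v_l`, that is, of nonzero coefficients of the components of `v(D)`. -/
noncomputable def weight (v : Fin n → F[X]) : ℕ :=
  ∑ j, (v j).support.card

/-- `d` is the free distance of `C`: the least weight of a nonzero codeword. -/
def IsFreeDistance (C : Submodule F[X] (Fin n → F[X])) (d : ℕ) : Prop :=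
  IsLeast {w | ∃ v ∈ C, v ≠ 0 ∧ weight v = w} d

/-- `C` is a convolutional code with parameters `(n, k, γ; m, d)` over `F`. -/
def HasParameters (C : Submodule F[X] (Fin n → F[X])) (k γ m d : ℕ) : Prop :=
  (∃ G : Matrix (Fin k) (Fin n) F[X], IsReducedBasic G ∧ generatedBy G = C ∧
    overallConstraintLength G = γ ∧ memory G = m) ∧ IsFreeDistance C d

/-- A convolutional code is MDS if it attains the generalized Singleton bound
`d ≤ (n - k) (⌊γ / k⌋ + 1) + γ + 1` with equality. -/
def IsMDS (C : Submodule F[X] (Fin n → F[X])) : Prop :=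
  ∃ k γ m d : ℕ, HasParameters C k γ m d ∧ d = (n - k) * (γ / k + 1) + γ + 1

end ConvCode

/-! Index the coordinates of `F^n`, `n = q + 1`, by the projective line, and test words against
forms of degree `m + 1`, where `m` is the redundancy. Let `Q` be a monic quadratic without roots.
The checks `H₀` (forms `Q X^j`, `j < m`) and `H₁` (forms `1, X`) together span all polynomials of
degree at most `m + 1`, so their common kernel is an MDS block code of distance `m + 3`. Since `Q`
never vanishes, the kernel of `H₀` alone has distance at least `m + 1`.

The convolutional code is given by `H₀ v_0 = 0` and `H₀ v_(l+1) = E(H₁ v_l)`, with `E` injecting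
`F^2` into the first two coordinates of `F^m`. If the first nonzero coefficient is killed by `H₁`,
it already weighs `m + 3`. Otherwise it weighs at least `m + 1`, and later coefficients add at least
2 (`isFreeDistance_unitMemoryMatrix`). Constant words of the block code attain `m + 3`. The degree
is the rank of `E`, which is 2, because every basic generator matrix needs that many nonconstant
rows. -/

namespace ConvCode

/-! ### Coefficient vectors, weights, and a lower bound on the constraint length -/

section Coefficients

variable {F : Type*} [Field F] {k n m : ℕ}

/-- The vector `v_l` in the expansion `v(D) = ∑ v_l D^l`. -/
def coeffVec (v : Fin n → F[X]) (l : ℕ) : Fin n → F := fun j => (v j).coeff l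

theorem coeffVec_eq_zero_iff (v : Fin n → F[X]) : (∀ l, coeffVec v l = 0) ↔ v = 0 := by
  constructor
  · intro h
    funext j
    ext l
    exact congrFun (h l) j
  · rintro rfl l
    funext j
    simp [coeffVec]

theorem sum_hammingNorm_coeffVec_le_weight [DecidableEq F] (v : Fin n → F[X]) (s : Finset ℕ) :
    ∑ l ∈ s, hammingNorm (coeffVec v l) ≤ weight v := by
  simp only [hammingNorm, Finset.card_filter, weight]
  rw [Finset.sum_comm]
  refine Finset.sum_le_sum fun j _ => ?_
  rw [← Finset.card_filter]
  refine Finset.card_le_card fun l hl => ?_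
  simpa [coeffVec] using (Finset.mem_filter.1 hl).2

theorem weight_C [DecidableEq F] (w : Fin n → F) :
    weight (fun j => C (w j)) = hammingNorm w := by
  simp only [weight, hammingNorm, Finset.card_filter]
  refine Finset.sum_congr rfl fun j _ => ?_
  split_ifs with h
  · simp [support_C h]
  · simp [not_not.1 h]

theorem rowDegree_le_iff (G : Matrix (Fin k) (Fin n) F[X]) (a : Fin k) (d : ℕ) :
    rowDegree G a ≤ d ↔ ∀ j, (G a j).natDegree ≤ d := by
  simp [rowDegree]

theorem IsBasic.linearIndependent {G : Matrix (Fin k) (Fin n) F[X]} (h : IsBasic G) :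
    LinearIndependent F[X] G.row := by
  obtain ⟨R, hR⟩ := h
  rw [← Matrix.vecMul_injective_iff]
  intro u u' huu
  have := congrArg (fun v => Matrix.vecMul v R) huu
  simpa [Matrix.vecMul_vecMul, hR] using this

theorem row_mem_generatedBy (G : Matrix (Fin k) (Fin n) F[X]) (a : Fin k) :
    G a ∈ generatedBy G :=
  ⟨Pi.single a 1, by simp [Matrix.row]⟩

/-- If the constant words of a code span a space of dimension at most `d`, then every
basic generator matrix has at least `k - d` rows of positive degree. -/
theorem IsBasic.le_overallConstraintLength {G : Matrix (Fin k) (Fin n) F[X]} (h : IsBasic G)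
    (W : Submodule F (Fin n → F))
    (hW : ∀ w : Fin n → F, (fun j => C (w j)) ∈ generatedBy G → w ∈ W) :
    k ≤ overallConstraintLength G + Module.finrank F W := by
  classical
  set s : Finset (Fin k) := Finset.univ.filter fun a => rowDegree G a = 0 with hs
  have hrow : ∀ a : s, G a = fun j => C ((G a j).coeff 0) := by
    intro a
    funext j
    have ha : rowDegree G a = 0 := (Finset.mem_filter.1 a.2).2
    exact eq_C_of_natDegree_le_zero ((rowDegree_le_iff G a 0).1 ha.le j)
  have hmem : ∀ a : s, (fun j => (G a j).coeff 0) ∈ W := fun a =>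
    hW _ (by rw [← hrow a]; exact row_mem_generatedBy G a)
  -- The degree-zero rows are constant words, and they stay independent over `F` because the rows of
  -- a basic matrix are independent over `F[X]`.
  have hli : LinearIndependent F fun a : s => (⟨_, hmem a⟩ : W) := by
    rw [Fintype.linearIndependent_iff]
    intro c hc
    have h1 := (h.linearIndependent.comp (fun a : s => (a : Fin k)) Subtype.val_injective)
    rw [Fintype.linearIndependent_iff] at h1
    have h2 := h1 (fun a => C (c a)) (by
      funext j
      have h3 := congrArg (fun w : W => (w : Fin n → F) j) hc
      simp only [Submodule.coe_sum, Finset.sum_apply, Submodule.coe_smul, Pi.smul_apply,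
        smul_eq_mul, Submodule.coe_zero, Pi.zero_apply] at h3
      simp only [Function.comp, Matrix.row, Finset.sum_apply, Pi.smul_apply, smul_eq_mul,
        Pi.zero_apply]
      rw [← C_0, ← h3, map_sum]
      refine Finset.sum_congr rfl fun a _ => ?_
      rw [C_mul]
      exact congrArg _ (congrFun (hrow a) j))
    intro a
    simpa using h2 a
  have hcard : s.card ≤ Module.finrank F W := by
    simpa using hli.fintype_card_le_finrank
  have hsum : (Finset.univ.filter fun a => ¬ rowDegree G a = 0).card
      ≤ overallConstraintLength G := by
    rw [Finset.card_filter, overallConstraintLength]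
    refine Finset.sum_le_sum fun a _ => ?_
    split_ifs <;> omega
  have := Finset.card_filter_add_card_filter_not (s := (Finset.univ : Finset (Fin k)))
    (fun a => rowDegree G a = 0)
  rw [Finset.card_univ, Fintype.card_fin, ← hs] at this
  omega

end Coefficients

/-! ### Unit memory codes described by a syndrome recurrence -/

section UnitMemory

variable {F : Type*} [Field F] {k n m : ℕ}
  (T : (Fin n → F) ≃ₗ[F] (Fin k → F) × (Fin m → F)) (E : (Fin k → F) →ₗ[F] (Fin m → F))

/-- In the coordinates given by `T`, the generator matrix `[1 | D E]`. -/
noncomputable def unitMemoryMatrix : Matrix (Fin k) (Fin n) F[X] := fun a j =>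
  C (T.symm (Pi.single a 1, 0) j) + X * C (T.symm (0, E (Pi.single a 1)) j)

theorem sum_mul_apply_single (f : (Fin k → F) →ₗ[F] (Fin n → F)) (c : Fin k → F) (j : Fin n) :
    ∑ a, c a * f (Pi.single a 1) j = f c j := by
  conv_rhs => rw [pi_eq_sum_univ' c]
  simp only [map_sum, map_smul, Finset.sum_apply, Pi.smul_apply, smul_eq_mul]

theorem vecMul_unitMemoryMatrix_apply (u : Fin k → F[X]) (j : Fin n) :
    Matrix.vecMul u (unitMemoryMatrix T E) j =
      ∑ a, u a * C (T.symm (Pi.single a 1, 0) j) +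
        X * ∑ a, u a * C (T.symm (0, E (Pi.single a 1)) j) := by
  simp only [Matrix.vecMul, dotProduct, unitMemoryMatrix, Finset.mul_sum, ← Finset.sum_add_distrib]
  exact Finset.sum_congr rfl fun a _ => by ring

theorem coeffVec_zero_vecMul (u : Fin k → F[X]) :
    coeffVec (Matrix.vecMul u (unitMemoryMatrix T E)) 0 = T.symm (coeffVec u 0, 0) := by
  funext j
  rw [coeffVec, vecMul_unitMemoryMatrix_apply]
  simp only [coeff_add, finsetSum_coeff, coeff_mul_C, coeff_X_mul_zero, add_zero]
  exact sum_mul_apply_single (T.symm.toLinearMap ∘ₗ LinearMap.inl F _ _) (coeffVec u 0) j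

theorem coeffVec_succ_vecMul (u : Fin k → F[X]) (l : ℕ) :
    coeffVec (Matrix.vecMul u (unitMemoryMatrix T E)) (l + 1) =
      T.symm (coeffVec u (l + 1), E (coeffVec u l)) := by
  funext j
  rw [coeffVec, vecMul_unitMemoryMatrix_apply]
  simp only [coeff_add, finsetSum_coeff, coeff_mul_C, coeff_X_mul]
  have h1 := sum_mul_apply_single (T.symm.toLinearMap ∘ₗ LinearMap.inl F _ _)
    (coeffVec u (l + 1)) j
  have h2 := sum_mul_apply_single (T.symm.toLinearMap ∘ₗ LinearMap.inr F _ _ ∘ₗ E)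
    (coeffVec u l) j
  have h3 : ((coeffVec u (l + 1), E (coeffVec u l)) : (Fin k → F) × (Fin m → F)) =
    (coeffVec u (l + 1), 0) + (0, E (coeffVec u l)) := by simp
  rw [h3, map_add, Pi.add_apply]
  exact congrArg₂ _ h1 h2

theorem coeffVec_zero_of_mem {v : Fin n → F[X]} (hv : v ∈ generatedBy (unitMemoryMatrix T E)) :
    (T (coeffVec v 0)).2 = 0 := by
  obtain ⟨u, rfl⟩ := hv
  rw [Matrix.vecMulLinear_apply, coeffVec_zero_vecMul, T.apply_symm_apply]

/-- Parity-check side of the code: the syndrome of each coefficient is dictated by the previous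
coefficient. -/
theorem coeffVec_succ_of_mem {v : Fin n → F[X]} (hv : v ∈ generatedBy (unitMemoryMatrix T E))
    (l : ℕ) : (T (coeffVec v (l + 1))).2 = E (T (coeffVec v l)).1 := by
  obtain ⟨u, rfl⟩ := hv
  rw [Matrix.vecMulLinear_apply, coeffVec_succ_vecMul, T.apply_symm_apply]
  cases l with
  | zero => rw [coeffVec_zero_vecMul, T.apply_symm_apply]
  | succ l => rw [coeffVec_succ_vecMul, T.apply_symm_apply]

theorem constant_mem_generatedBy {w : Fin n → F} (h : (T w).2 = 0) (hE : E (T w).1 = 0) :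
    (fun j => C (w j)) ∈ generatedBy (unitMemoryMatrix T E) := by
  refine ⟨fun a => C ((T w).1 a), ?_⟩
  rw [Matrix.vecMulLinear_apply]
  have h0 : coeffVec (fun a => C ((T w).1 a)) 0 = (T w).1 := by
    funext a; simp [coeffVec]
  have hs : ∀ l, coeffVec (fun a => C ((T w).1 a)) (l + 1) = 0 := by
    intro l; funext a; simp [coeffVec]
  have hw : T.symm ((T w).1, 0) = w := by rw [← h, Prod.mk.eta, T.symm_apply_apply]
  funext j
  ext l
  rcases l with _ | l
  · have := congrFun (coeffVec_zero_vecMul T E (fun a => C ((T w).1 a))) j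
    rw [h0, hw] at this
    simpa [coeffVec] using this
  · have := congrFun (coeffVec_succ_vecMul T E (fun a => C ((T w).1 a)) l) j
    rw [hs] at this
    cases l with
    | zero =>
      rw [h0, hE, Prod.mk_zero_zero, map_zero] at this
      simpa [coeffVec, coeff_C] using this
    | succ l =>
      rw [hs, map_zero, Prod.mk_zero_zero, map_zero] at this
      simpa [coeffVec, coeff_C] using this

/-- The constant matrix of the first component of `T` is a right inverse: it kills the `D`-part,
which lies in the second factor. -/
theorem isBasic_unitMemoryMatrix : IsBasic (unitMemoryMatrix T E) := by
  refine ⟨Matrix.of fun j b => C ((T (Pi.single j 1)).1 b), ?_⟩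
  have key : ∀ (w : Fin n → F) (b : Fin k), ∑ j, w j * (T (Pi.single j 1)).1 b = (T w).1 b :=
    fun w b => sum_mul_apply_single (LinearMap.fst F _ _ ∘ₗ T.toLinearMap) w b
  ext1 a b
  have h : (unitMemoryMatrix T E * Matrix.of fun j b => C ((T (Pi.single j 1)).1 b)) a b =
      C (∑ j, T.symm (Pi.single a 1, 0) j * (T (Pi.single j 1)).1 b) +
        X * C (∑ j, T.symm (0, E (Pi.single a 1)) j * (T (Pi.single j 1)).1 b) := by
    simp only [Matrix.mul_apply, Matrix.of_apply, unitMemoryMatrix, map_sum, Finset.mul_sum, C_mul,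
      ← Finset.sum_add_distrib]
    exact Finset.sum_congr rfl fun j _ => by ring
  rw [h, key, key, T.apply_symm_apply, T.apply_symm_apply]
  by_cases hab : a = b
  · subst hab; simp
  · simp [Matrix.one_apply_ne hab, Ne.symm hab]

theorem rowDegree_unitMemoryMatrix_le (a : Fin k) : rowDegree (unitMemoryMatrix T E) a ≤ 1 := by
  rw [rowDegree_le_iff]
  intro j
  unfold unitMemoryMatrix
  compute_degree

theorem rowDegree_unitMemoryMatrix_eq_zero {a : Fin k} (ha : E (Pi.single a 1) = 0) :
    rowDegree (unitMemoryMatrix T E) a = 0 := by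
  rw [← Nat.le_zero, rowDegree_le_iff]
  intro j
  simp only [unitMemoryMatrix, ha, Prod.mk_zero_zero, map_zero, Pi.zero_apply, mul_zero, add_zero]
  simp

/-- A constant word of the code has zero syndrome and its first component in `ker E`, so constant
words span at most `dim (ker E)` dimensions; rank-nullity does the rest. -/
theorem finrank_range_le_overallConstraintLength {G : Matrix (Fin k) (Fin n) F[X]}
    (hG : IsBasic G) (h : generatedBy G = generatedBy (unitMemoryMatrix T E)) :
    Module.finrank F (LinearMap.range E) ≤ overallConstraintLength G := by
  have h1 := hG.le_overallConstraintLength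
    ((LinearMap.ker E).map (T.symm.toLinearMap ∘ₗ LinearMap.inl F _ _)) (by
      intro w hw
      rw [h] at hw
      have h0 : coeffVec (fun j => C (w j)) 0 = w := by funext j; simp [coeffVec]
      have h1 : coeffVec (fun j => C (w j)) (0 + 1) = 0 := by
        funext j; simp [coeffVec]
      have h2 := coeffVec_zero_of_mem T E hw
      have h3 := coeffVec_succ_of_mem T E hw 0
      rw [h1, h0, map_zero] at h3
      rw [h0] at h2
      refine ⟨(T w).1, h3.symm, ?_⟩
      change T.symm ((T w).1, 0) = w
      rw [← h2, Prod.mk.eta, T.symm_apply_apply])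
  have h2 := Submodule.finrank_map_le (T.symm.toLinearMap ∘ₗ LinearMap.inl F _ _)
    (LinearMap.ker E)
  have h3 := LinearMap.finrank_range_add_finrank_ker E
  rw [Module.finrank_fin_fun] at h3
  omega

theorem overallConstraintLength_unitMemoryMatrix_le (s : Finset (Fin k))
    (hs : ∀ a ∉ s, E (Pi.single a 1) = 0) :
    overallConstraintLength (unitMemoryMatrix T E) ≤ s.card := by
  rw [overallConstraintLength, ← Finset.sum_subset (Finset.subset_univ s)
    fun a _ ha => rowDegree_unitMemoryMatrix_eq_zero T E (hs a ha), Finset.card_eq_sum_ones]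
  exact Finset.sum_le_sum fun a _ => rowDegree_unitMemoryMatrix_le T E a

theorem hasParameters_unitMemoryMatrix (s : Finset (Fin k))
    (hs : ∀ a ∉ s, E (Pi.single a 1) = 0) (hcard : s.card ≤ Module.finrank F (LinearMap.range E))
    (hpos : 0 < s.card) (d : ℕ) (hd : IsFreeDistance (generatedBy (unitMemoryMatrix T E)) d) :
    HasParameters (generatedBy (unitMemoryMatrix T E)) k s.card 1 d := by
  have hlen : overallConstraintLength (unitMemoryMatrix T E) = s.card :=
    le_antisymm (overallConstraintLength_unitMemoryMatrix_le T E s hs) (hcard.trans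
      (finrank_range_le_overallConstraintLength T E (isBasic_unitMemoryMatrix T E) rfl))
  refine ⟨⟨_, ⟨isBasic_unitMemoryMatrix T E, fun G' hG' h => ?_⟩, rfl, hlen, ?_⟩, hd⟩
  · rw [hlen]
    exact hcard.trans <| finrank_range_le_overallConstraintLength T E hG' h
  · refine le_antisymm (Finset.sup_le fun a _ => rowDegree_unitMemoryMatrix_le T E a) ?_
    by_contra hlt
    have h0 : memory (unitMemoryMatrix T E) = 0 := by omega
    have : overallConstraintLength (unitMemoryMatrix T E) = 0 :=
      Finset.sum_eq_zero fun a ha => Nat.le_zero.1 (h0 ▸ Finset.le_sup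
        (f := fun i => rowDegree (unitMemoryMatrix T E) i) ha)
    omega

end UnitMemory

/-! ### Evaluation codes on the projective line -/

section ProjectiveLine

variable {F : Type*} [Field F] {ι : Type*} [Fintype ι]

/-- Evaluation of a polynomial, seen as a form of degree `N`, at a point of the projective line. -/
noncomputable def evalProj (N : ℕ) : Option F → F[X] →ₗ[F] F
  | none => lcoeff F N
  | some x => leval x

/-- The functional `f ↦ ∑ w_i f(P_i)` on polynomials, as a function of `w`. -/
noncomputable def pairing (N : ℕ) (e : ι → Option F) : F[X] →ₗ[F] (ι → F) →ₗ[F] F :=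
  LinearMap.mk₂ F (fun f w => ∑ i, w i * evalProj N (e i) f)
    (fun f g w => by simp only [map_add, mul_add, Finset.sum_add_distrib])
    (fun c f w => by
      simp only [map_smul, smul_eq_mul, Finset.mul_sum]
      exact Finset.sum_congr rfl fun i _ => by ring)
    (fun f w w' => by simp only [Pi.add_apply, add_mul, Finset.sum_add_distrib])
    (fun c f w => by
      simp only [Pi.smul_apply, smul_eq_mul, Finset.mul_sum]
      exact Finset.sum_congr rfl fun i _ => by ring)

theorem pairing_apply (N : ℕ) (e : ι → Option F) (f : F[X]) (w : ι → F) :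
    pairing N e f w = ∑ i, w i * evalProj N (e i) f := rfl

/-- The doubly extended Reed–Solomon code is MDS. -/
theorem lt_hammingNorm_of_pairing_eq_zero [DecidableEq F] {N : ℕ} {e : ι → Option F}
    (he : e.Injective) {w : ι → F} (hw : w ≠ 0)
    (h : ∀ f : F[X], f.natDegree ≤ N → pairing N e f w = 0) : N + 1 < hammingNorm w := by
  classical
  by_contra! hle
  rw [hammingNorm] at hle
  set S : Finset ι := Finset.univ.filter fun i => w i ≠ 0 with hS
  have hmem : ∀ i, i ∈ S ↔ w i ≠ 0 := by simp [hS]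
  obtain ⟨i₀, hi₀⟩ := Function.ne_iff.1 hw
  have single : ∀ (f : F[X]) (i : ι), (∀ j ∈ S, j ≠ i → evalProj N (e j) f = 0) →
      pairing N e f w = w i * evalProj N (e i) f := by
    intro f i hf
    rw [pairing_apply]
    refine Finset.sum_eq_single i (fun j _ hj => ?_) (by simp)
    by_cases hj' : j ∈ S
    · rw [hf j hj' hj, mul_zero]
    · rw [not_not.1 (mt (hmem j).2 hj'), zero_mul]
  by_cases hx : ∃ i ∈ S, ∃ x, e i = some x
  · obtain ⟨i, hi, x, hx⟩ := hx
    -- The test form vanishes at every support point except `P_i`. If infinity is among those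
    -- points, it contributes no linear factor, so the degree drops below `N` and the form vanishes
    -- there too. The default in `getD` is never reached.
    set S' := (S.erase i).filter fun j => e j ≠ none with hS'
    set f : F[X] := ∏ j ∈ S', (X - C ((e j).getD 0)) with hf
    have hdeg : f.natDegree = S'.card := natDegree_finsetProd_X_sub_C_eq_card _ _
    have hcard : (S.erase i).card + 1 = S.card := Finset.card_erase_add_one hi
    have hle' : S'.card ≤ (S.erase i).card := Finset.card_filter_le _ _
    have h0 := h f (by omega)
    rw [single f i, mul_eq_zero, or_iff_right ((hmem i).1 hi), hx] at h0
    · change eval x f = 0 at h0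
      rw [hf, eval_prod, Finset.prod_eq_zero_iff] at h0
      obtain ⟨j, hj, hj0⟩ := h0
      obtain ⟨hj1, hj2⟩ := Finset.mem_filter.1 hj
      obtain ⟨y, hy⟩ := Option.ne_none_iff_exists'.1 hj2
      rw [hy] at hj0
      simp only [Option.getD_some, eval_sub, eval_X, eval_C, sub_eq_zero] at hj0
      exact (Finset.mem_erase.1 hj1).1 (he (by rw [hx, hy, hj0]))
    · intro j hj hji
      rcases hy : e j with _ | y
      · change f.coeff N = 0
        apply coeff_eq_zero_of_natDegree_lt
        have : S'.card < (S.erase i).card := Finset.card_lt_card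
          (Finset.filter_ssubset.2 ⟨j, Finset.mem_erase.2 ⟨hji, hj⟩, by simp [hy]⟩)
        omega
      · change eval y f = 0
        rw [hf, eval_prod]
        refine Finset.prod_eq_zero (i := j)
          (Finset.mem_filter.2 ⟨Finset.mem_erase.2 ⟨hji, hj⟩, by simp [hy]⟩) ?_
        simp [hy]
  · push Not at hx
    have hnone : ∀ i ∈ S, e i = none := fun i hi =>
      Option.eq_none_iff_forall_ne_some.2 (hx i hi)
    have hi₀' := (hmem i₀).2 hi₀
    have h0 := h (X ^ N) (natDegree_X_pow_le N)
    rw [single _ i₀ fun j hj hji => absurd (he ((hnone j hj).trans (hnone i₀ hi₀').symm)) hji,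
      hnone i₀ hi₀'] at h0
    refine hi₀ ?_
    simpa [evalProj] using h0

/-- A monic `Q` without roots is nonzero at every point, infinity included, so multiplying by it
only rescales coordinates and leaves weights unchanged. -/
theorem lt_hammingNorm_of_pairing_mul_eq_zero [DecidableEq F] {N : ℕ} {e : ι → Option F}
    (he : e.Injective) {w : ι → F} (hw : w ≠ 0) {Q : F[X]} (hQ : Q.Monic)
    (hroot : ∀ x, Q.eval x ≠ 0)
    (h : ∀ f : F[X], f.natDegree ≤ N → pairing (N + Q.natDegree) e (Q * f) w = 0) :
    N + 1 < hammingNorm w := by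
  let c : Option F → F := fun P => P.elim 1 fun x => Q.eval x
  have hc : ∀ P, c P ≠ 0 := by rintro (_ | x) <;> simp [c, hroot]
  have hn : hammingNorm (fun i => w i * c (e i)) = hammingNorm w := by
    simp [hammingNorm, hc]
  rw [← hn]
  refine lt_hammingNorm_of_pairing_eq_zero he ?_ fun f hf => ?_
  · obtain ⟨i, hi⟩ := Function.ne_iff.1 hw
    exact Function.ne_iff.2 ⟨i, mul_ne_zero hi (hc _)⟩
  · rw [← h f hf, pairing_apply, pairing_apply]
    refine Finset.sum_congr rfl fun i _ => ?_
    rw [mul_assoc]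
    congr 1
    rcases e i with _ | x
    · change 1 * f.coeff N = (Q * f).coeff _
      rw [add_comm, coeff_mul_add_eq_of_natDegree_le le_rfl hf, hQ.coeff_natDegree]
    · exact (eval_mul ..).symm

theorem map_mul_eq_zero_of_natDegree_lt {M : Type*} [AddCommGroup M] [Module F M]
    (φ : F[X] →ₗ[F] M) (Q : F[X]) {d : ℕ} (h : ∀ j < d, φ (Q * X ^ j) = 0) {f : F[X]}
    (hf : f.natDegree < d) : φ (Q * f) = 0 := by
  rw [f.as_sum_range_C_mul_X_pow' hf, Finset.mul_sum, map_sum]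
  refine Finset.sum_eq_zero fun j hj => ?_
  rw [show Q * (C (f.coeff j) * X ^ j) = f.coeff j • (Q * X ^ j) by rw [smul_eq_C_mul]; ring,
    map_smul, h j (Finset.mem_range.1 hj), smul_zero]

/-- Division by `Q`: the quotient is handled by the multiples `Q X^j`, the remainder by the low
powers of `X`. -/
theorem map_eq_zero_of_monic {M : Type*} [AddCommGroup M] [Module F M] (φ : F[X] →ₗ[F] M)
    {Q : F[X]} (hQ : Q.Monic) (hQ0 : 0 < Q.natDegree) {d : ℕ} (h : ∀ j < d, φ (Q * X ^ j) = 0)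
    (h' : ∀ j < Q.natDegree, φ (X ^ j) = 0) {f : F[X]} (hd : 0 < d)
    (hf : f.natDegree < d + Q.natDegree) : φ f = 0 := by
  rw [← modByMonic_add_div f Q, map_add,
    map_mul_eq_zero_of_natDegree_lt φ Q h (by rw [natDegree_divByMonic f hQ]; omega), add_zero]
  rw [← one_mul (f %ₘ Q)]
  refine map_mul_eq_zero_of_natDegree_lt φ 1 (by simpa using h')
    (natDegree_modByMonic_lt f hQ fun h1 => ?_)
  simp [h1] at hQ0

/-- On a finite field `x ^ 2 - x` takes the same value at 0 and 1, hence misses some `c`. -/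
theorem exists_monic_quadratic_without_root [Finite F] :
    ∃ Q : F[X], Q.Monic ∧ Q.natDegree = 2 ∧ ∀ x, Q.eval x ≠ 0 := by
  have hinj : ¬ Function.Injective fun x : F => x ^ 2 - x := fun h =>
    zero_ne_one (h (by simp : (0 : F) ^ 2 - 0 = 1 ^ 2 - 1))
  have hsurj : ¬ Function.Surjective fun x : F => x ^ 2 - x :=
    mt Finite.injective_iff_surjective.2 hinj
  obtain ⟨c, hc⟩ := not_forall.1 hsurj
  refine ⟨X ^ 2 - X - C c, by monicity!, by compute_degree!, fun x hx => hc ⟨x, ?_⟩⟩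
  simpa [sub_eq_zero] using hx

end ProjectiveLine

/-! ### Coordinates adapted to a surjection, and Singleton-type bounds -/

section LinearAlgebra

variable {F : Type*} [Field F]

theorem exists_linearEquiv_snd_eq {V W : Type*} [AddCommGroup V] [Module F V]
    [FiniteDimensional F V] [AddCommGroup W] [Module F W] (f : V →ₗ[F] W)
    (hf : Function.Surjective f) (d : ℕ)
    (hd : Module.finrank F V = d + Module.finrank F W) :
    ∃ T : V ≃ₗ[F] (Fin d → F) × W, ∀ v, (T v).2 = f v := by
  obtain ⟨g, hg⟩ := (LinearMap.ker f).subtype.exists_leftInverse_of_injective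
    (Submodule.ker_subtype _)
  have hg' : ∀ x : LinearMap.ker f, g x = x := fun x => LinearMap.congr_fun hg x
  have hker : Module.finrank F (LinearMap.ker f) = Module.finrank F (Fin d → F) := by
    have h1 := LinearMap.finrank_range_add_finrank_ker f
    rw [LinearMap.range_eq_top.2 hf, finrank_top] at h1
    rw [Module.finrank_fin_fun]
    omega
  let T₀ := LinearMap.equivProdOfSurjectiveOfIsCompl f g (LinearMap.range_eq_top.2 hf)
    (LinearMap.range_eq_top.2 fun x => ⟨x, hg' x⟩) (LinearMap.isCompl_of_proj hg')
  exact ⟨T₀ ≪≫ₗ LinearEquiv.prodComm F _ _ ≪≫ₗ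
    (LinearEquiv.ofFinrankEq _ _ hker).prodCongr (LinearEquiv.refl F W), fun v => rfl⟩

theorem hammingNorm_extend_le [DecidableEq F] {d n : ℕ} (g : Fin d → Fin n) (c : Fin d → F) :
    hammingNorm (Function.extend g c 0) ≤ d := by
  classical
  refine (Finset.card_le_card (t := Finset.univ.image g) fun j hj => ?_).trans
    (Finset.card_image_le.trans (by simp))
  by_contra hn
  refine (Finset.mem_filter.1 hj).2 (Function.extend_apply' _ _ _ fun ⟨a, ha⟩ => hn ?_)
  exact Finset.mem_image.2 ⟨a, Finset.mem_univ a, ha⟩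

/-- A linear map `F^n → W` is onto if the minimum distance of its kernel exceeds `dim W ≤ n`. -/
theorem surjective_of_lt_hammingNorm [DecidableEq F] {n : ℕ} {W : Type*} [AddCommGroup W]
    [Module F W] [FiniteDimensional F W] (f : (Fin n → F) →ₗ[F] W) (hn : Module.finrank F W ≤ n)
    (h : ∀ w ≠ 0, f w = 0 → Module.finrank F W < hammingNorm w) : Function.Surjective f := by
  have hi := (Fin.castLE_injective hn)
  let ext := Function.ExtendByZero.linearMap F (Fin.castLE hn)
  have hext : Function.Injective ext := Function.extend_injective hi 0
  have hinj : Function.Injective (f ∘ₗ ext) := by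
    rw [injective_iff_map_eq_zero]
    intro c hc
    by_contra hc0
    have h1 := h (ext c) (fun h0 => hc0 (hext (h0.trans (map_zero ext).symm))) hc
    exact absurd (hammingNorm_extend_le (Fin.castLE hn) c) (not_le.2 h1)
  have hsurj := (LinearMap.injective_iff_surjective_of_finrank_eq_finrank
    (Module.finrank_fin_fun F)).1 hinj
  exact Function.Surjective.of_comp hsurj

/-- The Singleton bound. -/
theorem exists_hammingNorm_le [DecidableEq F] {n : ℕ} {W : Type*} [AddCommGroup W]
    [Module F W] [FiniteDimensional F W] (f : (Fin n → F) →ₗ[F] W) (hn : Module.finrank F W < n) :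
    ∃ w ≠ 0, f w = 0 ∧ hammingNorm w ≤ Module.finrank F W + 1 := by
  let ext := Function.ExtendByZero.linearMap F (Fin.castLE hn)
  have hext : Function.Injective ext := Function.extend_injective (Fin.castLE_injective hn) 0
  obtain ⟨c, hc, hc0⟩ := Submodule.exists_mem_ne_zero_of_ne_bot
    (LinearMap.ker_ne_bot_of_finrank_lt (f := f ∘ₗ ext) (by simp))
  exact ⟨ext c, fun h0 => hc0 (hext (h0.trans (map_zero ext).symm)), hc,
    hammingNorm_extend_le (Fin.castLE hn) c⟩

end LinearAlgebra

/-! ### Free distance and construction of the codes -/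

section FreeDistance

variable {F : Type*} [Field F] {k n m : ℕ}

theorem isFreeDistance_unitMemoryMatrix [DecidableEq F]
    (T : (Fin n → F) ≃ₗ[F] (Fin k → F) × (Fin m → F)) (E : (Fin k → F) →ₗ[F] (Fin m → F)) (d : ℕ)
    (hfull : ∀ w ≠ 0, (T w).2 = 0 → E (T w).1 = 0 → d ≤ hammingNorm w)
    (hfirst : ∀ w ≠ 0, (T w).2 = 0 → d ≤ hammingNorm w + 2)
    (hlast : ∀ w ≠ 0, E (T w).1 = 0 → (T w).2 ∈ LinearMap.range E → 2 ≤ hammingNorm w)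
    (hex : ∃ w ≠ 0, (T w).2 = 0 ∧ E (T w).1 = 0 ∧ hammingNorm w ≤ d) :
    IsFreeDistance (generatedBy (unitMemoryMatrix T E)) d := by
  classical
  constructor
  · obtain ⟨w, hw0, hw, hwE, hwd⟩ := hex
    refine ⟨_, constant_mem_generatedBy T E hw hwE, fun h => hw0 ?_, ?_⟩
    · funext j
      exact C_eq_zero.1 (congrFun h j)
    · rw [weight_C]
      exact le_antisymm hwd (hfull w hw0 hw hwE)
  · rintro _ ⟨v, hv, hv0, rfl⟩
    have hne : ∃ l, coeffVec v l ≠ 0 := by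
      by_contra! h
      exact hv0 ((coeffVec_eq_zero_iff v).1 h)
    set p := Nat.find hne with hp
    have hp0 : coeffVec v p ≠ 0 := Nat.find_spec hne
    have hp2 : (T (coeffVec v p)).2 = 0 := by
      rcases hpc : p with _ | l
      · exact coeffVec_zero_of_mem T E hv
      · have hl : coeffVec v l = 0 := not_not.1 (Nat.find_min hne (m := l) (by omega))
        rw [coeffVec_succ_of_mem T E hv, hl]
        simp
    by_cases hpE : E (T (coeffVec v p)).1 = 0
    · have := sum_hammingNorm_coeffVec_le_weight v {p}
      rw [Finset.sum_singleton] at this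
      exact (hfull _ hp0 hp2 hpE).trans this
    -- The next coefficient now has nonzero syndrome. Either it ends the propagation and `hlast`
    -- gives it weight 2, or it forces a third nonzero coefficient.
    · have hsucc := coeffVec_succ_of_mem T E hv p
      have hp1 : coeffVec v (p + 1) ≠ 0 := by
        intro h
        rw [h, map_zero] at hsucc
        exact hpE hsucc.symm
      have hd := hfirst _ hp0 hp2
      by_cases hE1 : E (T (coeffVec v (p + 1))).1 = 0
      · have h2 := hlast _ hp1 hE1 ⟨_, hsucc.symm⟩
        have := sum_hammingNorm_coeffVec_le_weight v {p, p + 1}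
        rw [Finset.sum_pair (by omega)] at this
        omega
      · have hp2 : coeffVec v (p + 2) ≠ 0 := by
          intro h
          have hs := coeffVec_succ_of_mem T E hv (p + 1)
          rw [h, map_zero] at hs
          exact hE1 hs.symm
        have h1 := hammingNorm_pos_iff.2 hp1
        have h2 := hammingNorm_pos_iff.2 hp2
        have := sum_hammingNorm_coeffVec_le_weight v {p, p + 1, p + 2}
        rw [Finset.sum_insert (by simp), Finset.sum_pair (by omega)] at this
        omega

/-- The linear map `F^(k+2) → F^m` that copies the last two coordinates to the first two. -/
def shiftMap (F : Type*) [Field F] (k m : ℕ) : (Fin (k + 2) → F) →ₗ[F] (Fin m → F) :=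
  LinearMap.pi fun j => if h : j.1 < 2 then LinearMap.proj (Fin.natAdd k ⟨j, h⟩) else 0

theorem shiftMap_apply_castLE (hm : 2 ≤ m) (c : Fin (k + 2) → F) (j : Fin 2) :
    shiftMap F k m c (Fin.castLE hm j) = c (Fin.natAdd k j) := by
  rw [shiftMap, LinearMap.pi_apply, dif_pos (show (Fin.castLE hm j : ℕ) < 2 from j.2)]
  rfl

theorem shiftMap_apply_of_le (c : Fin (k + 2) → F) {j : Fin m} (hj : 2 ≤ j.1) :
    shiftMap F k m c j = 0 := by
  rw [shiftMap, LinearMap.pi_apply, dif_neg (not_lt.2 hj), LinearMap.zero_apply]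

theorem shiftMap_eq_zero_iff (hm : 2 ≤ m) (c : Fin (k + 2) → F) :
    shiftMap F k m c = 0 ↔ ∀ j : Fin 2, c (Fin.natAdd k j) = 0 := by
  constructor
  · intro h j
    rw [← shiftMap_apply_castLE hm c, h, Pi.zero_apply]
  · intro h
    funext j
    by_cases hj : j.1 < 2
    · exact (shiftMap_apply_castLE hm c ⟨j, hj⟩).trans (h _)
    · exact shiftMap_apply_of_le c (not_lt.1 hj)

theorem two_le_finrank_range_shiftMap (hm : 2 ≤ m) :
    2 ≤ Module.finrank F (LinearMap.range (shiftMap F k m)) := by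
  let π : (Fin m → F) →ₗ[F] (Fin 2 → F) := LinearMap.funLeft F F (Fin.castLE hm)
  have hsurj : LinearMap.range (π ∘ₗ shiftMap F k m) = ⊤ := by
    rw [LinearMap.range_eq_top]
    intro b
    refine ⟨Fin.append 0 b, ?_⟩
    funext j
    exact (shiftMap_apply_castLE hm _ j).trans (Fin.append_right _ _ j)
  have h := Submodule.finrank_map_le π (LinearMap.range (shiftMap F k m))
  rw [← LinearMap.range_comp, hsurj, finrank_top, Module.finrank_fin_fun] at h
  exact h

/-- Over a finite field with `n - 1` elements there are unit memory MDS convolutional codes of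
length `n`, degree `2` and redundancy `m`. -/
theorem exists_hasParameters [Fintype F] (hF : Fintype.card F + 1 = k + 2 + m) (hm : 3 ≤ m)
    (hk : 0 < k) :
    ∃ C : Submodule F[X] (Fin (k + 2 + m) → F[X]), HasParameters C (k + 2) 2 1 (m + 3) := by
  classical
  obtain ⟨Q, hQ, hQ2, hroot⟩ := exists_monic_quadratic_without_root (F := F)
  obtain ⟨e⟩ : Nonempty (Fin (k + 2 + m) ≃ Option F) :=
    ⟨Fintype.equivOfCardEq (by rw [Fintype.card_fin, Fintype.card_option, hF])⟩
  let φ := pairing (m + 1) e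
  let H₀ : (Fin (k + 2 + m) → F) →ₗ[F] (Fin m → F) := LinearMap.pi fun j => φ (Q * X ^ (j : ℕ))
  let H₁ : (Fin (k + 2 + m) → F) →ₗ[F] (Fin 2 → F) := LinearMap.pi fun j => φ (X ^ (j : ℕ))
  have hφ₀ : ∀ {w}, H₀ w = 0 → ∀ j < m, φ (Q * X ^ j) w = 0 :=
    fun h j hj => congrFun h ⟨j, hj⟩
  have hφ₁ : ∀ {w}, H₁ w = 0 → ∀ j < 2, φ (X ^ j) w = 0 :=
    fun h j hj => congrFun h ⟨j, hj⟩
  have hfirst : ∀ w ≠ 0, H₀ w = 0 → m < hammingNorm w := by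
    intro w hw h
    have := lt_hammingNorm_of_pairing_mul_eq_zero (N := m - 1) e.injective hw hQ hroot
      fun f hf => map_mul_eq_zero_of_natDegree_lt
        (φ := (pairing (m - 1 + Q.natDegree) e).flip w) Q (d := m)
        (fun j hj => by
          rw [hQ2, show m - 1 + 2 = m + 1 by omega]
          exact hφ₀ h j hj) (by omega)
    omega
  have hfull : ∀ w ≠ 0, H₀ w = 0 → H₁ w = 0 → m + 2 < hammingNorm w := by
    intro w hw h h'
    exact lt_hammingNorm_of_pairing_eq_zero e.injective hw fun f hf =>
      map_eq_zero_of_monic (φ.flip w) hQ (by omega) (d := m) (hφ₀ h)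
        (by rw [hQ2]; exact hφ₁ h') (by omega) (by omega)
  have hprod : Module.finrank F ((Fin m → F) × (Fin 2 → F)) = m + 2 := by simp
  have hzero : ∀ w, H₀.prod H₁ w = 0 ↔ H₀ w = 0 ∧ H₁ w = 0 := fun w => Prod.mk_eq_zero
  have hsurj : Function.Surjective (H₀.prod H₁) := by
    refine surjective_of_lt_hammingNorm _ (by omega) fun w hw h => ?_
    rw [hprod]
    exact hfull w hw ((hzero w).1 h).1 ((hzero w).1 h).2
  obtain ⟨T₀, hT₀⟩ := exists_linearEquiv_snd_eq _ hsurj k (by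
    rw [hprod, Module.finrank_fin_fun]; omega)
  -- Regroups `T₀` so that `H₁` fills the last two coordinates of `F^(k+2)`, where `shiftMap` reads
  -- them, and `H₀` is the second factor.
  let T : (Fin (k + 2 + m) → F) ≃ₗ[F] (Fin (k + 2) → F) × (Fin m → F) :=
    T₀ ≪≫ₗ (LinearEquiv.refl F _).prodCongr (LinearEquiv.prodComm F _ _) ≪≫ₗ
      (LinearEquiv.prodAssoc F _ _ _).symm ≪≫ₗ
      ((LinearEquiv.sumArrowLequivProdArrow _ _ F F).symm ≪≫ₗ
        LinearEquiv.funCongrLeft F F finSumFinEquiv.symm).prodCongr (LinearEquiv.refl F _)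
  have hT₂ : ∀ w, (T w).2 = H₀ w := fun w => congrArg Prod.fst (hT₀ w)
  have hT₁ : ∀ w j, (T w).1 (Fin.natAdd k j) = H₁ w j := by
    intro w j
    rw [show H₁ w j = (T₀ w).2.2 j from (congrFun (congrArg Prod.snd (hT₀ w)) j).symm]
    exact congrArg
      ((LinearEquiv.sumArrowLequivProdArrow _ _ F F).symm ((T₀ w).1, (T₀ w).2.2))
      (finSumFinEquiv_symm_apply_natAdd j)
  let E := shiftMap F k m
  have hE : ∀ w, E (T w).1 = 0 ↔ H₁ w = 0 := by
    intro w
    rw [shiftMap_eq_zero_iff (by omega)]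
    simp only [hT₁, funext_iff, Pi.zero_apply]
  let s : Finset (Fin (k + 2)) := Finset.univ.image (Fin.natAdd k)
  have hs : s.card = 2 := by
    rw [Finset.card_image_of_injective _ (Fin.natAdd_injective 2 k), Finset.card_univ,
      Fintype.card_fin]
  refine ⟨generatedBy (unitMemoryMatrix T E), ?_⟩
  have hd : IsFreeDistance (generatedBy (unitMemoryMatrix T E)) (m + 3) := by
    apply isFreeDistance_unitMemoryMatrix
    · intro w hw h h'
      exact hfull w hw (hT₂ w ▸ h) ((hE w).1 h')
    · intro w hw h
      have := hfirst w hw (hT₂ w ▸ h)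
      omega
    · intro w hw h h'
      obtain ⟨c, hc⟩ := h'
      have h0 : φ 1 w = 0 := by
        rw [← pow_zero X]
        exact hφ₁ ((hE w).1 h) 0 two_pos
      -- The last syndrome coordinate is outside the image of `E` because `m ≥ 3`. A word of weight
      -- 1 would violate `φ 1 w = 0` at a finite point, and this equation at infinity, where the
      -- monic form of degree `m + 1` has value 1.
      have hlast : φ (Q * X ^ (m - 1)) w = 0 := by
        change H₀ w ⟨m - 1, by omega⟩ = 0
        rw [← hT₂, ← hc]
        exact shiftMap_apply_of_le c (show 2 ≤ m - 1 by omega)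
      by_contra! hlt
      have h1 : hammingNorm w = 1 := by
        have := hammingNorm_pos_iff.2 hw
        omega
      obtain ⟨i, hi⟩ := Finset.card_eq_one.1 h1
      have hmem : ∀ j, w j ≠ 0 ↔ j = i := by
        intro j
        have := Finset.ext_iff.1 hi j
        simpa using this
      have hsingle : ∀ f, φ f w = w i * evalProj (m + 1) (e i) f := by
        intro f
        refine (pairing_apply _ _ f w).trans
          (Finset.sum_eq_single i (fun j _ hj => ?_) fun hi => absurd (Finset.mem_univ i) hi)
        rw [not_not.1 (mt (hmem j).1 hj), zero_mul]
      have hwi := (hmem i).2 rfl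
      rw [hsingle, mul_eq_zero, or_iff_right hwi] at h0 hlast
      rcases hx : e i with _ | x <;> rw [hx] at h0 hlast
      · change (Q * X ^ (m - 1)).coeff (m + 1) = 0 at hlast
        rw [show m + 1 = Q.natDegree + (m - 1) by omega, coeff_mul_X_pow, hQ.coeff_natDegree]
          at hlast
        exact one_ne_zero hlast
      · exact one_ne_zero ((eval_one (x := x)).symm.trans h0)
    · obtain ⟨w, hw, h, hle⟩ := exists_hammingNorm_le (H₀.prod H₁) (by omega)
      rw [hprod] at hle
      obtain ⟨h1, h2⟩ := (hzero w).1 h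
      exact ⟨w, hw, (hT₂ w).trans h1, (hE w).2 h2, hle⟩
  have := hasParameters_unitMemoryMatrix T E s ?_ (by
    rw [hs]; exact two_le_finrank_range_shiftMap (by omega)) (by omega) _ hd
  · rwa [hs] at this
  · intro a ha
    rw [shiftMap_eq_zero_iff (by omega)]
    intro j
    refine Pi.single_eq_of_ne (fun h => ha ?_) _
    exact h ▸ Finset.mem_image_of_mem _ (Finset.mem_univ j)

end FreeDistance

end ConvCode

theorem mainTheorem9 {F : Type*} [Field F] [Fintype F] (q t n r k : ℕ)
    (ht : 3 ≤ t) (hq : q = 2 ^ t) (hF : Fintype.card F = q) (hn : n = q + 1)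
    (α : Fˣ) (hr : orderOf α = r) (hk : q - 1 = r * k)
    (i : ℕ) (hi : 2 ≤ i) (hi' : i ≤ (n - 1) / 2 - 2) :
    (∃ C : Submodule (Polynomial F) (Fin n → Polynomial F),
      ConvCode.HasParameters C (n - 2 * i) 2 1 (2 * i + 3) ∧ ConvCode.IsMDS C) ∧
    (∃ C : Submodule (Polynomial F) (Fin n → Polynomial F),
      ConvCode.HasParameters C (n - 2 * i + 1) 2 1 (2 * i + 2) ∧ ConvCode.IsMDS C) := by
  have key : ∀ κ m d : ℕ, n = κ + m → 3 ≤ m → 3 ≤ κ → d = m + 3 →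
      ∃ C : Submodule (Polynomial F) (Fin n → Polynomial F),
        ConvCode.HasParameters C κ 2 1 d ∧ ConvCode.IsMDS C := by
    rintro κ m d h hm hκ rfl
    -- Since `κ ≥ 3`, the floor of `2 / κ` is 0 and the Singleton bound reads `m + 3`.
    obtain ⟨κ, rfl⟩ : ∃ κ', κ = κ' + 2 := ⟨κ - 2, by omega⟩
    subst h
    obtain ⟨C, hC⟩ := ConvCode.exists_hasParameters (F := F) (k := κ) (m := m) (by omega) hm
      (by omega)
    refine ⟨C, hC, _, _, _, _, hC, ?_⟩
    rw [Nat.div_eq_of_lt (by omega), Nat.add_sub_cancel_left]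
    omega
  exact ⟨key _ (2 * i) _ (by omega) (by omega) (by omega) rfl,
    key _ (2 * i - 1) _ (by omega) (by omega) (by omega) (by omega)⟩
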